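/- Consider a full-duplex cellular network seen from a typical user (UE) located at the origin $o\in\mathbb R^2$. The interfering base stations (BSs), that is, all active BSs except the one serving the typical UE, form a homogeneous Poisson point process $\{x_i\}$ on $\mathbb R^2$ with intensity $\lambda_b>0$. The BS at $x_i$ transmits with random power $P_i\ge 0$, and its dedicated UE, located at $m(x_i)$, transmits with constant power $P_u\ge 0$. The pairs $(P_i,\,m(x_i)-x_i)$ are i.i.d. with an arbitrary joint law (in particular, a Rayleigh link distance with uniform direction is allowed), the fading coefficients $h_i,h_i'$ are i.i.d. exponential with unit mean, and the points, the pairs and the fading are independent. Let $\alpha>2$ be the path loss exponent, $\delta=2/\alpha<1$, and suppose $\mathbb E\{P^\delta\}<\infty$, where $P$ is distributed as $P_i$ (this holds whenever there is a peak power constraint $P\le P_{\max}$). The interference at the typical UE is $$I=\sum_i\big(P_i h_i\|x_i\|^{-\alpha}+P_u h_i'\|m(x_i)\|^{-\alpha}\big).$$ Then, for every $s\ge 0$, under the approximation that each interfering BS and its dedicated UE are co-located (i.e. with $\|m(x_i)\|$ replaced by $\|x_i\|$ in $I$), the Laplace transform $\mathcal L_I(s)=\mathbb E\{e^{-sI}\}$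 of the interference satisfies $$\mathcal L_I(s)\le\exp\Big(-\lambda_b\frac{\pi^2\delta}{\sin(\pi\delta)}\,s^\delta\,\mathbb E_P\Big\{\frac{P_u^{1+\delta}-P^{1+\delta}}{P_u-P}\Big\}\Big),$$ where the quotient is read as its limit $(1+\delta)P_u^\delta$ when $P=P_u$ and its expectation is finite; and the same upper bound holds for the Laplace transform of the interference $I$ itself, without this approximation. -/

import Mathlib

open MeasureTheory ProbabilityTheory
open scoped ENNReal

noncomputable section

/-- The plane `ℝ²` with the Euclidean norm and Lebesgue measure. -/
abbrev Plane : Type := EuclideanSpace ℝ (Fin 2)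

/-- Number of points of the configuration `x 0 ω, x 1 ω, …` (counted with multiplicity) in `B`. -/
def pointCount {Ω E : Type*} (x : ℕ → Ω → E) (B : Set E) (ω : Ω) : ℝ≥0∞ :=
  ∑' i, B.indicator (fun _ => (1 : ℝ≥0∞)) (x i ω)

/-- The random points `x 0, x 1, …` enumerate a Poisson point process with intensity measure `ν`:
the number of points in a set `B` of finite intensity is Poisson with mean `ν B`, and the numbers
of points in finitely many disjoint sets are independent. -/
structure IsPoissonProcess {Ω E : Type*} [MeasurableSpace Ω] [MeasurableSpace E]
    (μ : Measure Ω) (ν : Measure E) (x : ℕ → Ω → E) : Prop where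
  measurable : ∀ i, Measurable (x i)
  count_law : ∀ B : Set E, MeasurableSet B → ν B ≠ ∞ → ∀ n : ℕ,
    μ {ω | pointCount x B ω = n} =
      ENNReal.ofReal (Real.exp (-(ν B).toReal) * (ν B).toReal ^ n / (n.factorial : ℝ))
  indep : ∀ (n : ℕ) (B : Fin n → Set E), (∀ k, MeasurableSet (B k)) → (∀ k, ν (B k) ≠ ∞) →
    (Pairwise fun k l => Disjoint (B k) (B l)) →
    iIndepFun (fun k ω => pointCount x (B k) ω) μ

/-- The full-duplex network seen from the typical UE, which is at the origin. The points `x i` are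
the interfering (active) BSs, i.e. all of them except the typical UE's own BS; they form a
homogeneous Poisson point process of intensity `lam`. The BS at `x i` transmits with power `P i`,
its dedicated UE is at `x i + Y i`, and `h i`, `h' i` are the power fading coefficients from this
BS and from its UE to the origin. The marks are i.i.d. over `i` and independent of the points; the
fading is unit-mean exponential, and the pair (transmit power, displacement) has the law `κ` and
is independent of the fading. (Power and displacement of the same pair may be dependent, as for
fractional power control.) -/
structure IsFullDuplexNetwork {Ω : Type*} [MeasurableSpace Ω] (μ : Measure Ω) (lam : ℝ)
    (κ : Measure (ℝ × Plane)) (x : ℕ → Ω → Plane) (P : ℕ → Ω → ℝ) (Y : ℕ → Ω → Plane)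
    (h h' : ℕ → Ω → ℝ) : Prop where
  poisson : IsPoissonProcess μ (ENNReal.ofReal lam • (volume : Measure Plane)) x
  mark_law : ∀ i, HasLaw (fun ω => ((P i ω, Y i ω), (h i ω, h' i ω)))
    (κ.prod ((expMeasure 1).prod (expMeasure 1))) μ
  mark_indep : iIndepFun (fun i ω => ((P i ω, Y i ω), (h i ω, h' i ω))) μ
  point_mark_indep : IndepFun (fun ω i => x i ω)
    (fun ω i => ((P i ω, Y i ω), (h i ω, h' i ω))) μ

/-- Path loss `‖z‖ ^ (-α)` from `z` to the origin (infinite at `z = 0`). -/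
def pathLoss (α : ℝ) (z : Plane) : ℝ≥0∞ := ENNReal.ofReal ‖z‖ ^ (-α)

/-- Aggregate interference at the origin, when the BSs at `x i` transmit with power `P i` and
fading `h i`, and their UEs at `y i` transmit with power `Pu` and fading `h' i`. -/
def interference {Ω : Type*} (α Pu : ℝ) (x y : ℕ → Ω → Plane) (P h h' : ℕ → Ω → ℝ) (ω : Ω) :
    ℝ≥0∞ :=
  ∑' i, (ENNReal.ofReal (P i ω * h i ω) * pathLoss α (x i ω) +
    ENNReal.ofReal (Pu * h' i ω) * pathLoss α (y i ω))

/-- Laplace transform `𝔼[exp (-s I)]` of a nonnegative random variable `I`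
(with `exp (-∞) = 0`). -/
def laplaceTransform {Ω : Type*} [MeasurableSpace Ω] (μ : Measure Ω) (I : Ω → ℝ≥0∞) (s : ℝ) : ℝ :=
  ∫ ω, (if I ω = ∞ then 0 else Real.exp (-(s * (I ω).toReal))) ∂μ

/-- The quotient `(a ^ (1 + δ) - b ^ (1 + δ)) / (a - b)`, extended by continuity to `a = b`. -/
def powerQuotient (δ a b : ℝ) : ℝ :=
  if a = b then (1 + δ) * a ^ δ else (a ^ (1 + δ) - b ^ (1 + δ)) / (a - b)

end

/-! Averaging over the fading turns a BS at `x` with power `p`, and its UE displaced by `y`, into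
the factor `(1 - A x) * (1 - B (x + y))`, where `A = outage α (s * p)` and `B = outage α (s * Pu)`.
The generating functional of the Poisson process then bounds the Laplace transform by `exp (-T)`,
with `T` equal to `lam` times the mark average of `∫ (A + B(· + y) - A * B(· + y))`, so only lower
bounds on this integral matter. For `y = 0` partial fractions reduce it to `∫ outage α a =
spatialConst δ * a ^ δ`, which produces the power quotient (`lintegral_outage`,
`powerQuotient_le_integral`). A displacement keeps `∫ A + ∫ B` and can only shrink the overlap `∫ A
* B(· + y)`, since both functions decrease with the norm (`integral_outage_mul_displaced_le`). Hence
the co-located bound also holds for the true interference. The map `D` in `receivedPower` treats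
both models at once: `0` for co-location, `id` for the true positions. The generating functional is
needed only as an upper bound (`IsPoissonProcess.le_exp_of_le_lintegral_prod`), so finite products
and simple functions suffice. -/

open scoped NNReal

/-! ### Spatial integrals over the plane -/

lemma integral_exp_neg_mul_norm_rpow {α u : ℝ} (hα : 0 < α) (hu : 0 < u) :
    Integrable (fun x : Plane => Real.exp (-u * ‖x‖ ^ α)) ∧
    ∫ x : Plane, Real.exp (-u * ‖x‖ ^ α) =
      Real.pi * (2 / α) * Real.Gamma (2 / α) * u ^ (-(2 / α)) := by
  have hdim : Module.finrank ℝ Plane = 2 := by simp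
  constructor
  · have := (integrable_fun_norm_addHaar (volume : Measure Plane)
      (f := fun r => Real.exp (-u * r ^ α))).2
    apply this
    have h := integrableOn_rpow_mul_exp_neg_mul_rpow (p := α) (s := 1) (by norm_num) hα hu
    simpa [hdim] using h
  · have := integral_fun_norm_addHaar (volume : Measure Plane) (fun r => Real.exp (-u * r ^ α))
    rw [this]
    have h := integral_rpow_mul_exp_neg_mul_rpow (p := α) (q := 1) hα (by norm_num) hu
    simp only [Real.rpow_one] at h
    simp only [hdim, smul_eq_mul, nsmul_eq_mul, Nat.add_one_sub_one, pow_one, h]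
    have hv : (volume : Measure Plane).real (Metric.ball 0 1) = Real.pi := by
      simp [Measure.real, EuclideanSpace.volume_ball_fin_two, Real.pi_nonneg]
    rw [hv]
    norm_num
    rw [neg_div]
    ring

/-- The constant `π² δ / sin (π δ)`. -/
noncomputable def spatialConst (δ : ℝ) : ℝ := Real.pi ^ 2 * δ / Real.sin (Real.pi * δ)

lemma spatialConst_nonneg {δ : ℝ} (h0 : 0 < δ) (h1 : δ < 1) : 0 ≤ spatialConst δ := by
  have := Real.sin_pos_of_pos_of_lt_pi (x := Real.pi * δ) (by positivity)
    (by nlinarith [Real.pi_pos])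
  unfold spatialConst
  positivity

/-- The complementary Laplace transform of the faded power received from a point at `x`. -/
noncomputable def outage (α a : ℝ) (x : Plane) : ℝ := a / (‖x‖ ^ α + a)

lemma measurable_outage (α a : ℝ) : Measurable (outage α a) := by
  unfold outage; fun_prop

lemma outage_nonneg {α a : ℝ} (ha : 0 ≤ a) (x : Plane) : 0 ≤ outage α a x := by
  unfold outage; positivity

lemma outage_le_one {α a : ℝ} (ha : 0 ≤ a) (x : Plane) : outage α a x ≤ 1 := by
  unfold outage
  exact div_le_one_of_le₀ (by have : 0 ≤ ‖x‖ ^ α := by positivity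
                              linarith) (by positivity)

/-- Since `a / (r + a) = ∫ a * exp (-(r + a) * u) du` over `u > 0`, Tonelli leaves a
stretched-exponential integral over the plane, of order `u ^ (-δ)`, and then `Γ(1 - δ)`, finite
because `δ < 1`. The reflection formula for `Γ(δ) Γ(1 - δ)` supplies the sine. -/
lemma lintegral_outage {α a : ℝ} (hα : 2 < α) (ha : 0 < a) :
    ∫⁻ x, ENNReal.ofReal (outage α a x) =
      ENNReal.ofReal (spatialConst (2 / α) * a ^ (2 / α)) := by
  set δ := 2 / α with hδ
  have hδ0 : 0 < δ := by positivity
  have hδ1 : δ < 1 := by rw [hδ, div_lt_one] <;> linarith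
  have step1 : ∀ x : Plane, ENNReal.ofReal (outage α a x) =
      ∫⁻ u in Set.Ioi (0 : ℝ), ENNReal.ofReal (a * Real.exp (-(a * u))) *
        ENNReal.ofReal (Real.exp (-u * ‖x‖ ^ α)) := by
    intro x
    have hr : 0 < ‖x‖ ^ α + a := by positivity
    have hi := integrableOn_exp_mul_Ioi (a := -(‖x‖ ^ α + a)) (by linarith) 0
    have hv := integral_exp_mul_Ioi (a := -(‖x‖ ^ α + a)) (by linarith) 0
    have : outage α a x = ∫ u in Set.Ioi (0 : ℝ), a * Real.exp (-(‖x‖ ^ α + a) * u) := by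
      rw [integral_const_mul, hv, outage, mul_zero, Real.exp_zero, neg_div_neg_eq, mul_one_div]
    rw [this, ofReal_integral_eq_lintegral_ofReal (hi.const_mul a)
      (Filter.Eventually.of_forall fun u => by positivity)]
    congr 1 with u
    rw [← ENNReal.ofReal_mul (by positivity), mul_assoc, ← Real.exp_add]
    congr 3
    ring
  simp_rw [step1]
  rw [lintegral_lintegral_swap (by fun_prop)]
  have step2 : ∀ u ∈ Set.Ioi (0 : ℝ), ∫⁻ x : Plane, ENNReal.ofReal (a * Real.exp (-(a * u))) *
        ENNReal.ofReal (Real.exp (-u * ‖x‖ ^ α)) = ENNReal.ofReal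
        ((a * (Real.pi * δ * Real.Gamma δ)) * (u ^ ((1 - δ) - 1) * Real.exp (-(a * u)))) := by
    intro u hu
    obtain ⟨hi, hv⟩ := integral_exp_neg_mul_norm_rpow (α := α) (by linarith) hu
    rw [lintegral_const_mul _ (by fun_prop), ← ofReal_integral_eq_lintegral_ofReal hi
      (Filter.Eventually.of_forall fun x => by positivity), hv,
      ← ENNReal.ofReal_mul (by positivity)]
    rw [show (1 - δ) - 1 = -δ by ring]
    congr 1
    ring
  rw [setLIntegral_congr_fun measurableSet_Ioi step2]
  have hG := Real.integral_rpow_mul_exp_neg_mul_Ioi (a := 1 - δ) (r := a) (by linarith) ha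
  have hI : IntegrableOn (fun u : ℝ => u ^ ((1 - δ) - 1) * Real.exp (-(a * u))) (Set.Ioi 0) := by
    have := integrableOn_rpow_mul_exp_neg_mul_rpow (p := 1) (s := (1 - δ) - 1) (b := a)
      (by linarith) one_pos ha
    simpa using this
  rw [← ofReal_integral_eq_lintegral_ofReal (hI.const_mul _), integral_const_mul, hG]
  · congr 1
    have hrefl := Real.Gamma_mul_Gamma_one_sub δ
    have : a * (1 / a) ^ (1 - δ) = a ^ δ := by
      rw [one_div, Real.inv_rpow ha.le, ← Real.rpow_neg ha.le]
      nth_rewrite 1 [← Real.rpow_one a]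
      rw [← Real.rpow_add ha]
      congr 1; ring
    calc _ = Real.pi * δ * (Real.Gamma δ * Real.Gamma (1 - δ)) * (a * (1 / a) ^ (1 - δ)) := by ring
      _ = _ := by rw [hrefl, this, spatialConst]; ring
  · refine (ae_restrict_iff' measurableSet_Ioi).2 (Filter.Eventually.of_forall fun u hu => ?_)
    have : 0 < u := hu
    have := Real.Gamma_pos_of_pos hδ0
    positivity

lemma integrable_outage {α a : ℝ} (hα : 2 < α) (ha : 0 ≤ a) : Integrable (outage α a) := by
  rcases ha.eq_or_lt with rfl | ha
  · simp [show outage α 0 = fun _ => 0 by ext; simp [outage]]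
  · refine ⟨(measurable_outage α a).aestronglyMeasurable, ?_⟩
    rw [hasFiniteIntegral_iff_ofReal (Filter.Eventually.of_forall (outage_nonneg ha.le)),
      lintegral_outage hα ha]
    exact ENNReal.ofReal_lt_top

lemma integral_outage {α a : ℝ} (hα : 2 < α) (ha : 0 ≤ a) :
    ∫ x, outage α a x = spatialConst (2 / α) * a ^ (2 / α) := by
  have hδ0 : 0 < 2 / α := by positivity
  rcases ha.eq_or_lt with rfl | ha
  · simp [outage, Real.zero_rpow hδ0.ne']
  · rw [integral_eq_lintegral_of_nonneg_ae (Filter.Eventually.of_forall (outage_nonneg ha.le))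
      (measurable_outage α a).aestronglyMeasurable, lintegral_outage hα ha,
      ENNReal.toReal_ofReal]
    have := spatialConst_nonneg hδ0 (by rw [div_lt_one] <;> linarith)
    positivity

lemma outage_mono {α a b : ℝ} (ha : 0 ≤ a) (hab : a ≤ b) (x : Plane) :
    outage α a x ≤ outage α b x := by
  unfold outage
  have hr : 0 ≤ ‖x‖ ^ α := by positivity
  rcases ha.eq_or_lt with rfl | ha
  · simp; positivity
  · rw [div_le_div_iff₀ (by linarith) (by linarith)]
    nlinarith

lemma outage_anti {α a : ℝ} (hα : 0 < α) (ha : 0 ≤ a) {x y : Plane} (h : ‖x‖ ≤ ‖y‖) :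
    outage α a y ≤ outage α a x := by
  unfold outage
  have hr : 0 ≤ ‖x‖ ^ α := by positivity
  rcases ha.eq_or_lt with rfl | ha
  · simp
  · have := Real.rpow_le_rpow (norm_nonneg x) h hα.le
    gcongr

lemma integrable_outage_mul {α a b : ℝ} (hα : 2 < α) (ha : 0 ≤ a) (hb : 0 ≤ b) (y z : Plane) :
    Integrable (fun x => outage α a (x + y) * outage α b (x + z)) := by
  refine Integrable.mono' ((integrable_outage hα ha).comp_add_right y)
    (((measurable_outage α a).comp (measurable_add_const y)).mul
      ((measurable_outage α b).comp (measurable_add_const z))).aestronglyMeasurable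
    (Filter.Eventually.of_forall fun x => ?_)
  rw [Real.norm_of_nonneg (mul_nonneg (outage_nonneg ha _) (outage_nonneg hb _))]
  exact mul_le_of_le_one_right (outage_nonneg ha _) (outage_le_one hb _)

lemma outage_neg (α a : ℝ) (x : Plane) : outage α a (-x) = outage α a x := by simp [outage]

/-- Displacing one of two radially decreasing functions decreases the integral of the product. -/
lemma integral_outage_mul_displaced_le {α a b : ℝ} (hα : 2 < α) (ha : 0 ≤ a) (hb : 0 ≤ b)
    (y : Plane) :
    ∫ x, outage α a x * outage α b (x + y) ≤ ∫ x, outage α a x * outage α b x := by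
  have i00 := integrable_outage_mul hα ha hb 0 0
  have i11 := integrable_outage_mul hα ha hb y y
  have i01 := integrable_outage_mul hα ha hb 0 y
  have i10 := integrable_outage_mul hα ha hb y 0
  simp only [add_zero] at i00 i01 i10
  have e11 : ∫ x, outage α a (x + y) * outage α b (x + y) = ∫ x, outage α a x * outage α b x :=
    integral_add_right_eq_self (fun x => outage α a x * outage α b x) y
  -- The substitution `x ↦ -(x + y)` and evenness exchange the two shifted overlaps.
  have e10 : ∫ x, outage α a (x + y) * outage α b x = ∫ x, outage α a x * outage α b (x + y) := by
    rw [← integral_neg_eq_self, ← integral_add_right_eq_self _ y]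
    congr 1 with x
    rw [show -(x + y) + y = -x by abel, outage_neg, outage_neg]
  -- Rearrangement: `A` and `B` are both decreasing in the norm, so `(A x - A (x + y)) * (B x - B (x
  -- + y)) ≥ 0`.
  have key : ∀ x, outage α a (x + y) * outage α b x + outage α a x * outage α b (x + y) ≤
      outage α a x * outage α b x + outage α a (x + y) * outage α b (x + y) := by
    intro x
    rcases le_total ‖x‖ ‖x + y‖ with h | h <;>
    nlinarith [outage_anti (α := α) (by linarith) ha h, outage_anti (α := α) (by linarith) hb h]
  have := integral_mono (i10.add i01) (i00.add i11) key
  rw [integral_add' i10 i01, integral_add' i00 i11, e11, e10] at this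
  linarith

/-- Partial fractions: `A + B - A * B = (a * A - b * B) / (a - b)`, also at the origin, where a zero
parameter gives `0 / 0 = 0`. -/
lemma integral_union_outage {α a b : ℝ} (hα : 2 < α) (ha : 0 ≤ a) (hb : 0 ≤ b) (hab : a ≠ b) :
    ∫ x, (outage α a x + outage α b x - outage α a x * outage α b x) =
      spatialConst (2 / α) * powerQuotient (2 / α) a b := by
  have hδ0 : 0 < 2 / α := by positivity
  have hsub : a - b ≠ 0 := sub_ne_zero.2 hab
  have key : ∀ x : Plane, outage α a x + outage α b x - outage α a x * outage α b x =
      (a - b)⁻¹ * (a * outage α a x - b * outage α b x) := by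
    intro x
    unfold outage
    have hr : 0 ≤ ‖x‖ ^ α := by positivity
    rcases hr.eq_or_lt with h0 | hr
    · rw [← h0]
      rcases ha.eq_or_lt with rfl | ha
      · have : b ≠ 0 := fun h => hab h.symm
        field_simp; simp; ring
      · rcases hb.eq_or_lt with rfl | hb
        · field_simp; simp; ring
        · field_simp; ring
    · have h1 : ‖x‖ ^ α + a ≠ 0 := by positivity
      have h2 : ‖x‖ ^ α + b ≠ 0 := by positivity
      field_simp
      ring
  simp_rw [key]
  rw [integral_const_mul, integral_sub ((integrable_outage hα ha).const_mul _)
    ((integrable_outage hα hb).const_mul _), integral_const_mul, integral_const_mul,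
    integral_outage hα ha, integral_outage hα hb, powerQuotient, if_neg hab,
    Real.rpow_add_of_nonneg ha zero_le_one hδ0.le, Real.rpow_add_of_nonneg hb zero_le_one hδ0.le,
    Real.rpow_one, Real.rpow_one]
  field_simp

lemma integrable_union_outage {α a b : ℝ} (hα : 2 < α) (ha : 0 ≤ a) (hb : 0 ≤ b) (y : Plane) :
    Integrable (fun x => outage α a x + outage α b (x + y) -
      outage α a x * outage α b (x + y)) := by
  have h := integrable_outage_mul hα ha hb 0 y
  simp only [add_zero] at h
  exact ((integrable_outage hα ha).add ((integrable_outage hα hb).comp_add_right y)).sub h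

/-- On the diagonal, the derivative of `t ^ (1 + δ)` at `a` is the limit of its slopes from `c < a`.
Each slope is an off-diagonal integral, bounded by the diagonal one because `A + B - A * B`
increases with `B` when `A ≤ 1`; no limit under the integral is needed. -/
lemma powerQuotient_le_integral {α a b : ℝ} (hα : 2 < α) (ha : 0 ≤ a) (hb : 0 ≤ b) :
    spatialConst (2 / α) * powerQuotient (2 / α) a b ≤
      ∫ x, (outage α a x + outage α b x - outage α a x * outage α b x) := by
  have hδ0 : 0 < 2 / α := by positivity
  by_cases hab : a = b
  swap
  · exact (integral_union_outage hα ha hb hab).ge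
  subst hab
  rcases ha.eq_or_lt with rfl | ha
  · simp [powerQuotient, outage, Real.zero_rpow hδ0.ne']
  have hd := (Real.hasDerivAt_rpow_const (x := a) (p := 1 + 2 / α) (Or.inl ha.ne')).tendsto_slope
  have hd' := (hd.mono_left (nhdsWithin_mono a (show Set.Iio a ⊆ {a}ᶜ from fun x (hx : x < a) => hx.ne))).const_mul
    (spatialConst (2 / α))
  have : powerQuotient (2 / α) a a = (1 + 2 / α) * a ^ (1 + 2 / α - 1) := by
    simp [powerQuotient]
  rw [this]
  refine le_of_tendsto hd' ?_
  filter_upwards [Ioo_mem_nhdsLT ha] with c hc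
  have hi := integrable_union_outage hα ha.le ha.le 0
  have hi' := integrable_union_outage hα ha.le hc.1.le 0
  simp only [add_zero] at hi hi'
  have e : slope (fun x : ℝ => x ^ (1 + 2 / α)) a c = powerQuotient (2 / α) a c := by
    rw [slope_comm, slope_def_field, powerQuotient, if_neg hc.2.ne']
  rw [e, ← integral_union_outage hα ha.le hc.1.le hc.2.ne']
  refine integral_mono hi' hi fun x => ?_
  have h1 := outage_mono (α := α) hc.1.le hc.2.le x
  have h2 := outage_le_one (α := α) ha.le x
  dsimp only
  nlinarith

lemma powerQuotient_le_integral_displaced {α a b : ℝ} (hα : 2 < α) (ha : 0 ≤ a) (hb : 0 ≤ b)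
    (y : Plane) :
    spatialConst (2 / α) * powerQuotient (2 / α) a b ≤
      ∫ x, (outage α a x + outage α b (x + y) - outage α a x * outage α b (x + y)) := by
  refine (powerQuotient_le_integral hα ha hb).trans ?_
  have i0 := integrable_outage_mul hα ha hb 0 0
  have i1 := integrable_outage_mul hα ha hb 0 y
  simp only [add_zero] at i0 i1
  have iA := integrable_outage hα ha
  have iB := integrable_outage hα hb
  have iB' := iB.comp_add_right y
  rw [integral_sub (f := fun x => outage α a x + outage α b x) (iA.add iB) i0,
    integral_sub (f := fun x => outage α a x + outage α b (x + y)) (iA.add iB') i1, integral_add iA iB,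
    integral_add iA iB', integral_add_right_eq_self (outage α b) y]
  have := integral_outage_mul_displaced_le hα ha hb y
  linarith

lemma powerQuotient_comm (δ a b : ℝ) : powerQuotient δ a b = powerQuotient δ b a := by
  unfold powerQuotient
  by_cases h : a = b
  · simp [h]
  · rw [if_neg h, if_neg (Ne.symm h), ← neg_sub, ← neg_sub b a, neg_div_neg_eq]

lemma powerQuotient_mul {δ s a b : ℝ} (hs : 0 < s) (ha : 0 ≤ a) (hb : 0 ≤ b) :
    powerQuotient δ (s * a) (s * b) = s ^ δ * powerQuotient δ a b := by
  unfold powerQuotient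
  by_cases h : a = b
  · simp only [h, if_true, Real.mul_rpow hs.le hb]; ring
  · have h' : s * a ≠ s * b := by simpa [hs.ne'] using h
    have : a - b ≠ 0 := sub_ne_zero.2 h
    rw [if_neg h, if_neg h', Real.mul_rpow hs.le ha, Real.mul_rpow hs.le hb,
      Real.rpow_add hs, Real.rpow_one, ← mul_sub, ← mul_sub]
    field_simp

lemma powerQuotient_nonneg {δ a b : ℝ} (hδ : 0 ≤ δ) (ha : 0 ≤ a) (hb : 0 ≤ b) :
    0 ≤ powerQuotient δ a b := by
  wlog hab : b ≤ a generalizing a b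
  · rw [powerQuotient_comm]; exact this hb ha (le_of_not_ge hab)
  unfold powerQuotient
  split_ifs with h
  · positivity
  · exact div_nonneg (sub_nonneg.2 (Real.rpow_le_rpow hb hab (by linarith))) (sub_nonneg.2 hab)

/-- Gives the integrable majorant for the mark average. For `b ≤ a` it amounts to `b * a ^ δ ≤ a * b
^ δ`, that is, `b ^ (1 - δ) ≤ a ^ (1 - δ)`. -/
lemma powerQuotient_le {δ a b : ℝ} (hδ : 0 < δ) (hδ1 : δ < 1) (ha : 0 ≤ a) (hb : 0 ≤ b) :
    powerQuotient δ a b ≤ a ^ δ + b ^ δ := by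
  wlog hab : b ≤ a generalizing a b
  · rw [powerQuotient_comm, add_comm]; exact this hb ha (le_of_not_ge hab)
  unfold powerQuotient
  split_ifs with h
  · have : 0 ≤ a ^ δ := by positivity
    subst h; nlinarith
  · have hlt : b < a := lt_of_le_of_ne hab (Ne.symm h)
    rw [div_le_iff₀ (by linarith), Real.rpow_add_of_nonneg ha zero_le_one hδ.le,
      Real.rpow_add_of_nonneg hb zero_le_one hδ.le, Real.rpow_one, Real.rpow_one]
    have hx : b * a ^ δ ≤ a * b ^ δ := by
      have e : ∀ t : ℝ, 0 ≤ t → t = t ^ (1 - δ) * t ^ δ := fun t ht => by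
        rw [← Real.rpow_add_of_nonneg ht (by linarith) hδ.le]; simp
      calc b * a ^ δ = b ^ (1 - δ) * (b ^ δ * a ^ δ) := by
            nth_rewrite 1 [e b hb]; ring
        _ ≤ a ^ (1 - δ) * (b ^ δ * a ^ δ) := by
            gcongr
        _ = _ := by nth_rewrite 3 [e a ha]; ring
    nlinarith

lemma measurable_powerQuotient (δ a : ℝ) : Measurable (powerQuotient δ a) := by
  unfold powerQuotient
  refine Measurable.ite (measurableSet_eq_fun measurable_const measurable_id) ?_ ?_ <;> fun_prop

/-! ### Generating functional of a Poisson process -/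

lemma pointCount_eq_encard {Ω E : Type*} (x : ℕ → Ω → E) (B : Set E) (ω : Ω) :
    pointCount x B ω = ({i | x i ω ∈ B} : Set ℕ).encard := by
  rw [← ENNReal.tsum_set_one, tsum_subtype {i | x i ω ∈ B} (fun _ => (1 : ℝ≥0∞))]
  rfl

/-- When finitely many points lie in `B`, the products over the first points of the function equal
to `c` on `B` and to `1` elsewhere are eventually `c` to the number of points in `B`. -/
lemma eventually_prod_eq_rpow_pointCount {Ω E : Type*} {x : ℕ → Ω → E} {B : Set E}
    [DecidablePred (· ∈ B)] {ω : Ω} {n : ℕ} (h : pointCount x B ω = n) (c : ℝ≥0∞) :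
    ∀ᶠ N in Filter.atTop, ∏ i ∈ Finset.range N, (if x i ω ∈ B then c else 1) =
      c ^ (pointCount x B ω).toReal := by
  have hcard : ({i | x i ω ∈ B} : Set ℕ).encard = n := by
    rw [pointCount_eq_encard] at h
    exact_mod_cast h
  have hfin : ({i | x i ω ∈ B} : Set ℕ).Finite := Set.finite_of_encard_eq_coe hcard
  filter_upwards [Filter.tendsto_finset_range.eventually_ge_atTop hfin.toFinset] with N hN
  rw [Finset.prod_ite, Finset.prod_const_one, mul_one, Finset.prod_const, h]
  have hs : Finset.filter (fun i => x i ω ∈ B) (Finset.range N) = hfin.toFinset := by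
    ext i
    simp only [Finset.mem_filter, Set.Finite.mem_toFinset, Set.mem_ofPred_eq, and_iff_right_iff_imp]
    exact fun hi => hN (by simpa using hi)
  rw [hs]
  have : hfin.toFinset.card = n := by
    rw [hfin.encard_eq_coe_toFinset_card] at hcard
    exact_mod_cast hcard
  rw [this, ENNReal.toReal_natCast, ENNReal.rpow_natCast]

lemma pairwise_disjoint_pointCount_eq {Ω E : Type*} (x : ℕ → Ω → E) (B : Set E) :
    Pairwise (Function.onFun Disjoint fun n : ℕ => {ω | pointCount x B ω = n}) := by
  intro m n hmn
  refine Set.disjoint_left.2 fun ω hm hn => hmn ?_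
  have : (m : ℝ≥0∞) = n := (Eq.symm hm).trans hn
  exact_mod_cast this

section PoissonProcess

variable {Ω E : Type*} [MeasurableSpace Ω] [MeasurableSpace E] {μ : Measure Ω} {ν : Measure E}
  {x : ℕ → Ω → E}

lemma IsPoissonProcess.measurable_pointCount (hx : IsPoissonProcess μ ν x) {B : Set E}
    (hB : MeasurableSet B) : Measurable (pointCount x B) := by
  unfold pointCount
  exact Measurable.tsum fun i => (measurable_const.indicator hB).comp (hx.measurable i)

lemma tsum_ofReal_pow_mul_poisson {q m : ℝ} (hq : q ≤ 1) (hm : 0 ≤ m) :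
    ∑' n : ℕ, ENNReal.ofReal (1 - q) ^ n *
      ENNReal.ofReal (Real.exp (-m) * m ^ n / (n.factorial : ℝ)) =
      ENNReal.ofReal (Real.exp (-(q * m))) := by
  have hq' : 0 ≤ 1 - q := by linarith
  have hsum := (NormedSpace.expSeries_div_hasSum_exp ((1 - q) * m)).mul_left (Real.exp (-m))
  rw [← Real.exp_eq_exp_ℝ, ← Real.exp_add] at hsum
  rw [show -(q * m) = -m + (1 - q) * m by ring, ← hsum.tsum_eq,
    ENNReal.ofReal_tsum_of_nonneg (fun n => by positivity) hsum.summable]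
  congr 1 with n
  rw [← ENNReal.ofReal_pow hq', ← ENNReal.ofReal_mul (by positivity), mul_pow]
  congr 1
  ring

/-- The Poisson probabilities sum to one (the series above with `q = 0`), so an infinite count has
probability zero. -/
lemma IsPoissonProcess.ae_pointCount_eq_natCast [IsProbabilityMeasure μ]
    (hx : IsPoissonProcess μ ν x) {B : Set E} (hB : MeasurableSet B) (hνB : ν B ≠ ∞) :
    ∀ᵐ ω ∂μ, ω ∈ ⋃ n : ℕ, {ω | pointCount x B ω = n} := by
  have hmeas : ∀ n : ℕ, MeasurableSet {ω | pointCount x B ω = n} := fun n =>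
    hx.measurable_pointCount hB (measurableSet_singleton _)
  refine (mem_ae_iff_prob_eq_one (MeasurableSet.iUnion hmeas)).2 ?_
  rw [measure_iUnion (pairwise_disjoint_pointCount_eq x B) hmeas]
  simp_rw [hx.count_law B hB hνB]
  simpa using tsum_ofReal_pow_mul_poisson (q := 0) zero_le_one (ENNReal.toReal_nonneg (a := ν B))

lemma IsPoissonProcess.lintegral_rpow_pointCount [IsProbabilityMeasure μ]
    (hx : IsPoissonProcess μ ν x) {B : Set E} (hB : MeasurableSet B) (hνB : ν B ≠ ∞)
    {q : ℝ} (hq : q ≤ 1) :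
    ∫⁻ ω, ENNReal.ofReal (1 - q) ^ (pointCount x B ω).toReal ∂μ =
      ENNReal.ofReal (Real.exp (-(q * (ν B).toReal))) := by
  have hmeas : ∀ n : ℕ, MeasurableSet {ω | pointCount x B ω = n} := fun n =>
    hx.measurable_pointCount hB (measurableSet_singleton _)
  have huniv : (⋃ n : ℕ, {ω | pointCount x B ω = n}) =ᵐ[μ] Set.univ :=
    Filter.eventuallyEq_univ.2 (hx.ae_pointCount_eq_natCast hB hνB)
  rw [← setLIntegral_univ, ← setLIntegral_congr huniv, lintegral_iUnion hmeas (pairwise_disjoint_pointCount_eq x B), ← tsum_ofReal_pow_mul_poisson hq ENNReal.toReal_nonneg]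
  congr 1 with n
  rw [setLIntegral_congr_fun (g := fun _ => ENNReal.ofReal (1 - q) ^ n) (hmeas n), setLIntegral_const,
    hx.count_law B hB hνB]
  intro ω (hω : pointCount x B ω = n)
  simp only [hω, ENNReal.toReal_natCast, ENNReal.rpow_natCast]

lemma IsPoissonProcess.iIndepFun_level_sets (hx : IsPoissonProcess μ ν x) {g : E → ℝ≥0}
    (hg : Measurable g) (S : Finset ℝ≥0) (hS : ∀ c ∈ S, ν (g ⁻¹' {c}) ≠ ∞) :
    iIndepFun (fun (c : S) ω => pointCount x (g ⁻¹' {(c : ℝ≥0)}) ω) μ := by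
  refine iIndepFun.of_precomp S.equivFin.symm.surjective ?_
  refine hx.indep _ (fun k => g ⁻¹' {(S.equivFin.symm k : ℝ≥0)})
    (fun k => hg (measurableSet_singleton _)) (fun k => hS _ (S.equivFin.symm k).2) ?_
  intro k l hkl
  refine Disjoint.preimage _ (Set.disjoint_singleton.2 fun h => hkl ?_)
  exact S.equivFin.symm.injective (Subtype.ext h)

/-- Upper bound by the generating functional of a simple function. -/
lemma IsPoissonProcess.le_exp_of_simpleFunc [IsProbabilityMeasure μ]
    (hx : IsPoissonProcess μ ν x) (g : SimpleFunc E ℝ≥0) (hg1 : ∀ y, g y ≤ 1)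
    (hg : ∫⁻ y, g y ∂ν ≠ ∞) {L : ℝ≥0∞}
    (hL : ∀ N, L ≤ ∫⁻ ω, ∏ i ∈ Finset.range N, ENNReal.ofReal (1 - (g (x i ω) : ℝ)) ∂μ) :
    L ≤ ENNReal.ofReal (Real.exp (-(∫⁻ y, g y ∂ν).toReal)) := by
  classical
  -- The level `0` is dropped: its fibre may have infinite intensity, and its points contribute the
  -- factor `1`.
  set S : Finset ℝ≥0 := g.range.erase 0 with hSdef
  have hB : ∀ c : ℝ≥0, MeasurableSet (g ⁻¹' {c}) := fun c => g.measurableSet_fiber c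
  have hνB : ∀ c ∈ S, ν (g ⁻¹' {c}) ≠ ∞ := by
    intro c hc htop
    have h0 : (c : ℝ≥0∞) ≠ 0 := by simpa using (Finset.mem_erase.1 hc).1
    have h := mul_meas_ge_le_lintegral (μ := ν) (f := fun y => (g y : ℝ≥0∞))
      g.measurable.coe_nnreal_ennreal c
    have h2 : ν {y | (c : ℝ≥0∞) ≤ g y} = ∞ := by
      refine measure_mono_top (fun y (hy : g y = c) => ?_) htop
      simp [hy]
    rw [h2, ENNReal.mul_top h0] at h
    exact hg (top_le_iff.1 h)
  have hS1 : ∀ c ∈ S, (c : ℝ) ≤ 1 := by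
    intro c hc
    obtain ⟨y, rfl⟩ := SimpleFunc.mem_range.1 (Finset.mem_of_mem_erase hc)
    exact_mod_cast hg1 y
  have hmemS : ∀ y, g y ∈ S ↔ g y ≠ 0 := fun y => by
    simp [hSdef]
  have hprod : ∀ y, ENNReal.ofReal (1 - (g y : ℝ)) =
      ∏ c ∈ S, if y ∈ g ⁻¹' {c} then ENNReal.ofReal (1 - (c : ℝ)) else 1 := by
    intro y
    simp only [Set.mem_preimage, Set.mem_singleton_iff, Finset.prod_ite_eq, hmemS]
    by_cases h : g y = 0 <;> simp [h]
  have hint : (∫⁻ y, g y ∂ν).toReal = ∑ c ∈ S, (c : ℝ) * (ν (g ⁻¹' {c})).toReal := by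
    have : ∀ y, (g y : ℝ≥0∞) = ∑ c ∈ S, (g ⁻¹' {c}).indicator (fun _ => (c : ℝ≥0∞)) y := by
      intro y
      simp only [Set.indicator, Set.mem_preimage, Set.mem_singleton_iff, Finset.sum_ite_eq, hmemS]
      by_cases h : g y = 0 <;> simp [h]
    simp_rw [this]
    rw [lintegral_finsetSum _ fun c _ => measurable_const.indicator (hB c)]
    simp_rw [lintegral_indicator_const (hB _)]
    rw [ENNReal.toReal_sum fun c hc => ENNReal.mul_ne_top ENNReal.coe_ne_top (hνB c hc)]
    simp
  have hmeasF : ∀ N, Measurable fun ω =>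
      ∏ i ∈ Finset.range N, ENNReal.ofReal (1 - (g (x i ω) : ℝ)) := by
    intro N
    refine Finset.measurable_fun_prod _ fun i _ => ?_
    exact ((measurable_const.sub (g.measurable.comp (hx.measurable i)).coe_nnreal_real)).ennreal_ofReal
  -- Almost surely each nonzero level is hit finitely often, so the partial products are eventually
  -- constant.
  have hlim : ∀ᵐ ω ∂μ, Filter.Tendsto
      (fun N => ∏ i ∈ Finset.range N, ENNReal.ofReal (1 - (g (x i ω) : ℝ))) Filter.atTop
      (nhds (∏ c ∈ S, ENNReal.ofReal (1 - (c : ℝ)) ^ (pointCount x (g ⁻¹' {c}) ω).toReal)) := by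
    have hae : ∀ᵐ ω ∂μ, ∀ c ∈ S, ω ∈ ⋃ n : ℕ, {ω | pointCount x (g ⁻¹' {c}) ω = n} :=
      (Finset.eventually_all S).2 fun c hc => hx.ae_pointCount_eq_natCast (hB c) (hνB c hc)
    filter_upwards [hae] with ω hω
    refine tendsto_const_nhds.congr' ?_
    have : ∀ᶠ N in Filter.atTop, ∀ c ∈ S, ∏ i ∈ Finset.range N,
        (if x i ω ∈ g ⁻¹' {c} then ENNReal.ofReal (1 - (c : ℝ)) else 1) =
        ENNReal.ofReal (1 - (c : ℝ)) ^ (pointCount x (g ⁻¹' {c}) ω).toReal := by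
      refine (Finset.eventually_all S).2 fun c hc => ?_
      obtain ⟨n, hn⟩ := Set.mem_iUnion.1 (hω c hc)
      exact eventually_prod_eq_rpow_pointCount hn _
    filter_upwards [this] with N hN
    simp_rw [hprod]
    rw [Finset.prod_comm]
    exact (Finset.prod_congr rfl hN).symm
  have hle := ge_of_tendsto' (tendsto_lintegral_of_dominated_convergence (μ := μ) (fun _ => 1) hmeasF
    (fun N => Filter.Eventually.of_forall fun ω => Finset.prod_le_one' fun i _ => by simp)
    (by simp) hlim) hL
  refine hle.trans_eq ?_
  have hind := (hx.iIndepFun_level_sets g.measurable S hνB).comp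
    (fun c t => ENNReal.ofReal (1 - (c : ℝ)) ^ t.toReal) (fun c => by fun_prop)
  have := lintegral_prod_eq_prod_lintegral_of_indepFun Finset.univ _ hind (fun c => by
    have := hx.measurable_pointCount (hB c)
    exact Measurable.comp (by fun_prop) this)
  simp only [Function.comp_apply] at this
  have e1 : ∀ ω, ∏ c ∈ S, ENNReal.ofReal (1 - (c : ℝ)) ^ (pointCount x (g ⁻¹' {c}) ω).toReal =
      ∏ c : S, ENNReal.ofReal (1 - (c : ℝ)) ^ (pointCount x (g ⁻¹' {(c : ℝ≥0)}) ω).toReal :=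
    fun ω => (Finset.prod_coe_sort S _).symm
  simp_rw [e1]
  rw [this, Finset.prod_coe_sort S (fun c => ∫⁻ ω, ENNReal.ofReal (1 - (c : ℝ)) ^
    (pointCount x (g ⁻¹' {c}) ω).toReal ∂μ), Finset.prod_congr rfl fun c hc =>
    hx.lintegral_rpow_pointCount (hB c) (hνB c hc) (hS1 c hc),
    ← ENNReal.ofReal_prod_of_nonneg fun c _ => (Real.exp_pos _).le, ← Real.exp_sum, hint,
    Finset.sum_neg_distrib]

/-- Upper bound by the probability generating functional of a Poisson process. -/
theorem IsPoissonProcess.le_exp_of_le_lintegral_prod [IsProbabilityMeasure μ] [SigmaFinite ν]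
    (hx : IsPoissonProcess μ ν x) {φ : E → ℝ≥0∞} (hφ1 : ∀ y, φ y ≤ 1)
    {L : ℝ≥0∞} (hL : ∀ N, L ≤ ∫⁻ ω, ∏ i ∈ Finset.range N, φ (x i ω) ∂μ)
    {T : ℝ} (hT : ENNReal.ofReal T ≤ ∫⁻ y, (1 - φ y) ∂ν) :
    L ≤ ENNReal.ofReal (Real.exp (-T)) := by
  -- A strict `t < T` leaves room for a simple function below `1 - φ` with finite integral above
  -- `t`, even when `∫ (1 - φ)` is infinite.
  have hlt : ∀ t < T, L ≤ ENNReal.ofReal (Real.exp (-t)) := by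
    intro t ht
    rcases lt_or_ge t 0 with h0 | h0
    -- For negative `t` the empty product already gives `L ≤ 1`.
    · refine (hL 0).trans ?_
      simp only [Finset.range_zero, Finset.prod_empty, lintegral_const, measure_univ, mul_one,
        ENNReal.one_le_ofReal, Real.one_le_exp_iff]
      linarith
    · have h1 : ENNReal.ofReal t < ∫⁻ y, ((1 - φ y).toNNReal : ℝ≥0∞) ∂ν := by
        refine ((ENNReal.ofReal_lt_ofReal_iff (by linarith)).2 ht).trans_le (hT.trans_eq ?_)
        congr 1 with y
        rw [ENNReal.coe_toNNReal (ENNReal.sub_ne_top ENNReal.one_ne_top)]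
      obtain ⟨g, hgle, hgfin, hglt⟩ := exists_lt_lintegral_simpleFunc_of_lt_lintegral h1
      have hg : ∀ y, (g y : ℝ≥0∞) ≤ 1 - φ y := fun y =>
        (ENNReal.coe_le_coe.2 (hgle y)).trans_eq
          (ENNReal.coe_toNNReal (ENNReal.sub_ne_top ENNReal.one_ne_top))
      have hg1 : ∀ y, g y ≤ 1 := fun y => by
        exact_mod_cast (hg y).trans tsub_le_self
      have hφg : ∀ y, φ y ≤ ENNReal.ofReal (1 - (g y : ℝ)) := by
        intro y
        rw [ENNReal.ofReal_sub _ (g y).coe_nonneg, ENNReal.ofReal_one, ENNReal.ofReal_coe_nnreal]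
        refine ENNReal.le_sub_of_add_le_left ENNReal.coe_ne_top ?_
        exact (add_le_add_left (hg y) _).trans_eq (tsub_add_cancel_of_le (hφ1 y))
      refine (hx.le_exp_of_simpleFunc g hg1 hgfin.ne fun N => (hL N).trans ?_).trans ?_
      · exact lintegral_mono fun ω => Finset.prod_le_prod' fun i _ => hφg _
      · refine ENNReal.ofReal_le_ofReal (Real.exp_le_exp.2 (neg_le_neg ?_))
        rw [← ENNReal.toReal_ofReal h0]
        exact ENNReal.toReal_mono hgfin.ne hglt.le
  have hc : Filter.Tendsto (fun t : ℝ => ENNReal.ofReal (Real.exp (-t))) (nhdsWithin T (Set.Iio T))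
      (nhds (ENNReal.ofReal (Real.exp (-T)))) := by
    refine (Continuous.tendsto ?_ T).mono_left nhdsWithin_le_nhds
    exact ENNReal.continuous_ofReal.comp (by fun_prop)
  refine ge_of_tendsto hc ?_
  filter_upwards [self_mem_nhdsWithin] with t ht using hlt t ht

end PoissonProcess

/-! ### Laplace kernel and independent marks -/

/-- `exp (-s t)` with `exp (-∞) = 0`. -/
noncomputable def expNeg (s : ℝ) (t : ℝ≥0∞) : ℝ := if t = ∞ then 0 else Real.exp (-(s * t.toReal))

lemma expNeg_nonneg (s : ℝ) (t : ℝ≥0∞) : 0 ≤ expNeg s t := by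
  unfold expNeg; split_ifs <;> positivity

lemma measurable_expNeg (s : ℝ) : Measurable (expNeg s) := by
  unfold expNeg
  exact Measurable.ite (measurableSet_singleton _) (by fun_prop) (by fun_prop)

lemma expNeg_anti {s : ℝ} (hs : 0 ≤ s) {a b : ℝ≥0∞} (hab : a ≤ b) : expNeg s b ≤ expNeg s a := by
  by_cases hb : b = ∞
  · rw [expNeg, if_pos hb]; exact expNeg_nonneg s a
  · have ha : a ≠ ∞ := ne_top_of_le_ne_top hb hab
    rw [expNeg, expNeg, if_neg hb, if_neg ha]
    have := ENNReal.toReal_mono hb hab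
    gcongr

lemma expNeg_zero (s : ℝ) : expNeg s 0 = 1 := by simp [expNeg]

lemma expNeg_le_one {s : ℝ} (hs : 0 ≤ s) (t : ℝ≥0∞) : expNeg s t ≤ 1 :=
  (expNeg_anti hs zero_le).trans_eq (expNeg_zero s)

lemma expNeg_add (s : ℝ) (a b : ℝ≥0∞) : expNeg s (a + b) = expNeg s a * expNeg s b := by
  by_cases ha : a = ∞
  · simp [expNeg, ha]
  by_cases hb : b = ∞
  · simp [expNeg, hb]
  rw [expNeg, expNeg, expNeg, if_neg ha, if_neg hb, if_neg (ENNReal.add_ne_top.2 ⟨ha, hb⟩),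
    ENNReal.toReal_add ha hb, ← Real.exp_add]
  ring_nf

lemma expNeg_sum (s : ℝ) (S : Finset ℕ) (f : ℕ → ℝ≥0∞) :
    expNeg s (∑ i ∈ S, f i) = ∏ i ∈ S, expNeg s (f i) := by
  classical
  induction S using Finset.induction_on with
  | empty => simp [expNeg_zero]
  | insert i S hi ih => rw [Finset.sum_insert hi, Finset.prod_insert hi, expNeg_add, ih]

lemma laplaceTransform_eq {Ω : Type*} [MeasurableSpace Ω] (μ : Measure Ω) (I : Ω → ℝ≥0∞) (s : ℝ) :
    laplaceTransform μ I s = ∫ ω, expNeg s (I ω) ∂μ := rfl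

/-- Dropping terms of the interference raises the kernel, which is multiplicative on finite sums.
Bounding the `enorm` of the integral requires no measurability of the infinite sum. -/
lemma ofReal_laplaceTransform_tsum_le {Ω : Type*} [MeasurableSpace Ω] (μ : Measure Ω)
    (f : ℕ → Ω → ℝ≥0∞) {s : ℝ} (hs : 0 ≤ s) (N : ℕ) :
    ENNReal.ofReal (laplaceTransform μ (fun ω => ∑' i, f i ω) s) ≤
      ∫⁻ ω, ∏ i ∈ Finset.range N, ENNReal.ofReal (expNeg s (f i ω)) ∂μ := by
  rw [laplaceTransform_eq, ← Real.enorm_of_nonneg (integral_nonneg fun ω => expNeg_nonneg s _)]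
  refine (enorm_integral_le_lintegral_enorm _).trans (lintegral_mono fun ω => ?_)
  rw [Real.enorm_of_nonneg (expNeg_nonneg s _),
    ← ENNReal.ofReal_prod_of_nonneg fun i _ => expNeg_nonneg s _, ← expNeg_sum]
  exact ENNReal.ofReal_le_ofReal (expNeg_anti hs (ENNReal.sum_le_tsum _))

/-- Averaging over i.i.d. marks independent of the points. -/
lemma lintegral_prod_marked {Ω E M : Type*} [MeasurableSpace Ω] [MeasurableSpace E]
    [MeasurableSpace M] {μ : Measure Ω} [IsProbabilityMeasure μ] {κ : Measure M}
    {x : ℕ → Ω → E} {m : ℕ → Ω → M} (hx : ∀ i, Measurable (x i)) (hm : ∀ i, HasLaw (m i) κ μ)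
    (hind : iIndepFun m μ) (hxm : IndepFun (fun ω i => x i ω) (fun ω i => m i ω) μ)
    {F : E → M → ℝ≥0∞} (hF : Measurable (Function.uncurry F)) (N : ℕ) :
    ∫⁻ ω, ∏ i ∈ Finset.range N, F (x i ω) (m i ω) ∂μ =
      ∫⁻ ω, ∏ i ∈ Finset.range N, ∫⁻ z, F (x i ω) z ∂κ ∂μ := by
  have : IsProbabilityMeasure κ := (hm 0).isProbabilityMeasure_iff.1 inferInstance
  have hX : Measurable fun ω i => x i ω := measurable_pi_iff.2 hx
  have hM : AEMeasurable (fun ω i => m i ω) μ := aemeasurable_pi_iff.2 fun i => (hm i).aemeasurable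
  have hG : Measurable fun q : (ℕ → E) × (ℕ → M) => ∏ i ∈ Finset.range N, F (q.1 i) (q.2 i) :=
    Finset.measurable_fun_prod _ fun i _ => by
      have : Measurable fun q : (ℕ → E) × (ℕ → M) => (q.1 i, q.2 i) := by fun_prop
      exact hF.comp this
  have hmap := (indepFun_iff_map_prod_eq_prod_map_map hX.aemeasurable hM).1 hxm
  have inner : ∀ a : ℕ → E, ∫⁻ b, ∏ i ∈ Finset.range N, F (a i) (b i) ∂(μ.map fun ω i => m i ω) =
      ∏ i ∈ Finset.range N, ∫⁻ z, F (a i) z ∂κ := by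
    intro a
    have hFa : ∀ i, Measurable (F (a i)) := fun i => hF.comp measurable_prodMk_left
    have hGa : Measurable fun b : ℕ → M => ∏ i ∈ Finset.range N, F (a i) (b i) :=
      hG.comp (measurable_prodMk_left (x := a))
    rw [lintegral_map' hGa.aemeasurable hM]
    -- `HasLaw` gives only a.e. measurability; measurable versions of the marks stay independent.
    have hmk : ∀ i, m i =ᵐ[μ] (hm i).aemeasurable.mk := fun i => (hm i).aemeasurable.ae_eq_mk
    have hind' := (hind.congr hmk).comp (fun i => F (a i)) hFa
    have hae : ∀ᵐ ω ∂μ, ∏ i ∈ Finset.range N, F (a i) (m i ω) =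
        ∏ i ∈ Finset.range N, (F (a i) ∘ (hm i).aemeasurable.mk) ω := by
      filter_upwards [ae_all_iff.2 hmk] with ω hω
      exact Finset.prod_congr rfl fun i _ => by rw [Function.comp_apply, ← hω i]
    rw [lintegral_congr_ae hae, lintegral_prod_eq_prod_lintegral_of_indepFun _ _ hind'
      fun i => (hFa i).comp (hm i).aemeasurable.measurable_mk]
    refine Finset.prod_congr rfl fun i _ => ?_
    have : ∫⁻ z, F (a i) z ∂κ = ∫⁻ ω, F (a i) (m i ω) ∂μ := by
      rw [← (hm i).map_eq, lintegral_map' (hFa i).aemeasurable (hm i).aemeasurable]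
    rw [this]
    refine lintegral_congr_ae ?_
    filter_upwards [hmk i] with ω hω
    rw [Function.comp_apply, ← hω]
  calc _ = ∫⁻ q, ∏ i ∈ Finset.range N, F (q.1 i) (q.2 i)
        ∂(μ.map fun ω => ((fun i => x i ω), (fun i => m i ω))) := by
        rw [lintegral_map' hG.aemeasurable (hX.aemeasurable.prodMk hM)]
    _ = ∫⁻ a, ∏ i ∈ Finset.range N, ∫⁻ z, F (a i) z ∂κ ∂(μ.map fun ω i => x i ω) := by
        have : IsProbabilityMeasure (μ.map fun ω i => m i ω) := Measure.isProbabilityMeasure_map hM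
        rw [hmap, lintegral_prod _ hG.aemeasurable]
        simp_rw [inner]
    _ = _ := by
        have hφ : Measurable fun e => ∫⁻ z, F e z ∂κ := hF.lintegral_prod_right'
        have hΦ : Measurable fun a : ℕ → E => ∏ i ∈ Finset.range N, ∫⁻ z, F (a i) z ∂κ :=
          Finset.measurable_fun_prod _ fun i _ => hφ.comp (measurable_pi_apply i)
        rw [lintegral_map hΦ hX]

/-! ### Exponential fading and received power -/

lemma lintegral_exp_neg_mul_expMeasure {c : ℝ} (hc : 0 ≤ c) :
    ∫⁻ h, ENNReal.ofReal (Real.exp (-(c * h))) ∂(expMeasure 1) = ENNReal.ofReal (1 / (1 + c)) := by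
  have hpdf : Measurable (exponentialPDF 1) := (measurable_exponentialPDFReal 1).ennreal_ofReal
  have hdens : expMeasure 1 = volume.withDensity (exponentialPDF 1) := rfl
  rw [hdens, lintegral_withDensity_eq_lintegral_mul _ hpdf (by fun_prop)]
  have key : ∀ h : ℝ, (exponentialPDF 1 * fun h => ENNReal.ofReal (Real.exp (-(c * h)))) h =
      (Set.Ici 0).indicator (fun h => ENNReal.ofReal (Real.exp (-(1 + c) * h))) h := by
    intro h
    rw [Pi.mul_apply, exponentialPDF_eq]
    by_cases hh : 0 ≤ h
    · rw [Set.indicator_of_mem (Set.mem_Ici.2 hh), if_pos hh, ← ENNReal.ofReal_mul (by positivity), one_mul,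
        one_mul, ← Real.exp_add]
      ring_nf
    · rw [Set.indicator_of_notMem (mt Set.mem_Ici.1 hh), if_neg hh, ENNReal.ofReal_zero, zero_mul]
  simp_rw [key]
  rw [lintegral_indicator measurableSet_Ici, ← setLIntegral_congr Ioi_ae_eq_Ici,
    ← ofReal_integral_eq_lintegral_ofReal (integrableOn_exp_mul_Ioi (by linarith) 0)
      (Filter.Eventually.of_forall fun u => by positivity),
    integral_exp_mul_Ioi (by linarith), mul_zero, Real.exp_zero, neg_div_neg_eq]

lemma ae_expMeasure_nonneg : ∀ᵐ h ∂(expMeasure 1), 0 ≤ h := by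
  have hpdf : Measurable (exponentialPDF 1) := (measurable_exponentialPDFReal 1).ennreal_ofReal
  have hdens : expMeasure 1 = volume.withDensity (exponentialPDF 1) := rfl
  rw [hdens, ae_withDensity_iff hpdf]
  refine Filter.Eventually.of_forall fun h hh => ?_
  by_contra hneg
  exact hh (exponentialPDF_of_neg (not_le.1 hneg))

lemma measurable_pathLoss (α : ℝ) : Measurable (pathLoss α) := by
  unfold pathLoss; fun_prop

/-- The exponential transform `1 / (1 + c)` at `c = s * p * ‖x‖ ^ (-α)` is the complement of
`outage`; `x ≠ 0` keeps the path loss finite. -/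
lemma lintegral_expNeg_fading {α s p : ℝ} (hs : 0 ≤ s) (hp : 0 ≤ p) {x : Plane} (hx : x ≠ 0) :
    ∫⁻ h, ENNReal.ofReal (expNeg s (ENNReal.ofReal (p * h) * pathLoss α x)) ∂(expMeasure 1) =
      ENNReal.ofReal (1 - outage α (s * p) x) := by
  have hn : 0 < ‖x‖ := norm_pos_iff.2 hx
  have hr : 0 < ‖x‖ ^ α := by positivity
  have : ∀ᵐ h ∂(expMeasure 1),
      ENNReal.ofReal (expNeg s (ENNReal.ofReal (p * h) * pathLoss α x)) =
      ENNReal.ofReal (Real.exp (-(s * p * ‖x‖ ^ (-α) * h))) := by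
    filter_upwards [ae_expMeasure_nonneg] with h hh
    rw [pathLoss, ENNReal.ofReal_rpow_of_pos hn, ← ENNReal.ofReal_mul (by positivity), expNeg,
      if_neg ENNReal.ofReal_ne_top, ENNReal.toReal_ofReal (by positivity)]
    ring_nf
  rw [lintegral_congr_ae this, lintegral_exp_neg_mul_expMeasure (by positivity)]
  congr 1
  have h0 : 0 ≤ s * p := mul_nonneg hs hp
  rw [outage, Real.rpow_neg hn.le]
  field_simp
  ring

/-- Power received at the origin from a base station at `x` and its user, for the mark
`m = ((p, y), (h, h'))`, when the user is displaced by `D y`. -/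
noncomputable def receivedPower (α Pu : ℝ) (D : Plane → Plane) (x : Plane)
    (m : (ℝ × Plane) × (ℝ × ℝ)) : ℝ≥0∞ :=
  ENNReal.ofReal (m.1.1 * m.2.1) * pathLoss α x +
    ENNReal.ofReal (Pu * m.2.2) * pathLoss α (x + D m.1.2)

lemma measurable_receivedPower (α Pu : ℝ) {D : Plane → Plane} (hD : Measurable D) :
    Measurable (Function.uncurry (receivedPower α Pu D)) := by
  have := measurable_pathLoss α
  unfold receivedPower Function.uncurry
  fun_prop

lemma lintegral_expNeg_receivedPower {α Pu s : ℝ} (hPu : 0 ≤ Pu) (hs : 0 ≤ s) (D : Plane → Plane)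
    {x : Plane} {z : ℝ × Plane} (hz : 0 ≤ z.1) (hx : x ≠ 0) (hxz : x + D z.2 ≠ 0) :
    ∫⁻ f, ENNReal.ofReal (expNeg s (receivedPower α Pu D x (z, f)))
      ∂((expMeasure 1).prod (expMeasure 1)) =
      ENNReal.ofReal ((1 - outage α (s * z.1) x) * (1 - outage α (s * Pu) (x + D z.2))) := by
  have : IsProbabilityMeasure (expMeasure 1) := isProbabilityMeasure_expMeasure one_pos
  have hm := measurable_expNeg s
  simp_rw [receivedPower, expNeg_add, ENNReal.ofReal_mul (expNeg_nonneg s _)]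
  rw [lintegral_prod_mul (f := fun h => ENNReal.ofReal (expNeg s (ENNReal.ofReal (z.1 * h) *
      pathLoss α x))) (g := fun h => ENNReal.ofReal (expNeg s (ENNReal.ofReal (Pu * h) *
      pathLoss α (x + D z.2)))) (by fun_prop) (by fun_prop),
    lintegral_expNeg_fading hs hz hx, lintegral_expNeg_fading hs hPu hxz,
    ENNReal.ofReal_mul (sub_nonneg.2 (outage_le_one (mul_nonneg hs hz) x))]

lemma ofReal_powerQuotient_le_lintegral {α Pu s : ℝ} (hα : 2 < α) (hPu : 0 ≤ Pu) (hs : 0 < s)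
    (D : Plane → Plane) {z : ℝ × Plane} (hz : 0 ≤ z.1) :
    ENNReal.ofReal (spatialConst (2 / α) * s ^ (2 / α) * powerQuotient (2 / α) Pu z.1) ≤
      ∫⁻ x, (1 - ∫⁻ f, ENNReal.ofReal (expNeg s (receivedPower α Pu D x (z, f)))
        ∂((expMeasure 1).prod (expMeasure 1))) := by
  have ha : 0 ≤ s * z.1 := by positivity
  have hb : 0 ≤ s * Pu := by positivity
  have hae : ∀ᵐ x : Plane, ENNReal.ofReal (outage α (s * z.1) x + outage α (s * Pu) (x + D z.2) -
      outage α (s * z.1) x * outage α (s * Pu) (x + D z.2)) =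
      1 - ∫⁻ f, ENNReal.ofReal (expNeg s (receivedPower α Pu D x (z, f)))
        ∂((expMeasure 1).prod (expMeasure 1)) := by
    -- The BS or its UE sits at the origin only for these two positions, a null set.
    filter_upwards [Measure.ae_ne volume (0 : Plane), Measure.ae_ne volume (-D z.2)] with x h1 h2
    rw [lintegral_expNeg_receivedPower hPu hs.le D hz h1 (fun h => h2 (eq_neg_of_add_eq_zero_left h)),
      ← ENNReal.ofReal_one, ← ENNReal.ofReal_sub _ (mul_nonneg
        (sub_nonneg.2 (outage_le_one ha x)) (sub_nonneg.2 (outage_le_one hb _)))]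
    ring_nf
  rw [← lintegral_congr_ae hae, ← ofReal_integral_eq_lintegral_ofReal
    (integrable_union_outage hα ha hb (D z.2)) (Filter.Eventually.of_forall fun x => ?_)]
  · refine ENNReal.ofReal_le_ofReal ?_
    refine le_trans (le_of_eq ?_) (powerQuotient_le_integral_displaced hα ha hb (D z.2))
    rw [powerQuotient_mul hs hz hPu, powerQuotient_comm _ Pu]
    ring
  · have h1 := outage_nonneg (α := α) hb (x + D z.2)
    have h2 := outage_le_one (α := α) ha x
    have h3 := outage_nonneg (α := α) ha x
    simp only [Pi.zero_apply]
    nlinarith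

lemma one_sub_lintegral_prod {A B : Type*} [MeasurableSpace A] [MeasurableSpace B]
    {κ : Measure A} {ρ : Measure B} [IsProbabilityMeasure κ] [IsProbabilityMeasure ρ]
    {G : A × B → ℝ≥0∞} (hG : Measurable G) (hG1 : ∀ q, G q ≤ 1) :
    1 - ∫⁻ q, G q ∂(κ.prod ρ) = ∫⁻ z, (1 - ∫⁻ f, G (z, f) ∂ρ) ∂κ := by
  have hle : ∀ z, ∫⁻ f, G (z, f) ∂ρ ≤ 1 := fun z =>
    (lintegral_mono fun f => hG1 (z, f)).trans_eq (by simp)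
  rw [lintegral_sub hG.lintegral_prod_right'
    (((lintegral_mono hle).trans_eq (by simp)).trans_lt ENNReal.one_lt_top).ne
    (Filter.Eventually.of_forall hle), lintegral_prod _ hG.aemeasurable]
  simp

lemma integrable_powerQuotient {δ Pu : ℝ} (hδ : 0 < δ) (hδ1 : δ < 1) (hPu : 0 ≤ Pu)
    {κ : Measure (ℝ × Plane)} [IsFiniteMeasure κ] (hP : ∀ᵐ z ∂κ, 0 ≤ z.1)
    (hmom : Integrable (fun z => z.1 ^ δ) κ) :
    Integrable (fun z => powerQuotient δ Pu z.1) κ := by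
  refine Integrable.mono' ((integrable_const (Pu ^ δ)).add hmom)
    ((measurable_powerQuotient δ Pu).comp measurable_fst).aestronglyMeasurable ?_
  filter_upwards [hP] with z hz
  rw [Real.norm_of_nonneg (powerQuotient_nonneg hδ.le hPu hz)]
  exact powerQuotient_le hδ hδ1 hPu hz

lemma measurable_ofReal_expNeg_receivedPower (α Pu s : ℝ) {D : Plane → Plane}
    (hD : Measurable D) :
    Measurable (Function.uncurry fun x m =>
      ENNReal.ofReal (expNeg s (receivedPower α Pu D x m))) :=
  ((measurable_expNeg s).comp (measurable_receivedPower α Pu hD)).ennreal_ofReal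

lemma measurable_lintegral_fading (α Pu s : ℝ) {D : Plane → Plane} (hD : Measurable D) :
    Measurable fun q : Plane × (ℝ × Plane) =>
      ∫⁻ f, ENNReal.ofReal (expNeg s (receivedPower α Pu D q.1 (q.2, f)))
        ∂((expMeasure 1).prod (expMeasure 1)) := by
  have : IsProbabilityMeasure (expMeasure 1) := isProbabilityMeasure_expMeasure one_pos
  have hassoc : Measurable fun q : (Plane × (ℝ × Plane)) × (ℝ × ℝ) =>
    (q.1.1, (q.1.2, q.2)) := by fun_prop
  exact Measurable.lintegral_prod_right'
    ((measurable_ofReal_expNeg_receivedPower α Pu s hD).comp hassoc)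

lemma one_sub_lintegral_mark {s : ℝ} (α Pu : ℝ) (hs : 0 ≤ s) {κ : Measure (ℝ × Plane)}
    [IsProbabilityMeasure κ] {D : Plane → Plane} (hD : Measurable D) (x : Plane) :
    1 - ∫⁻ m, ENNReal.ofReal (expNeg s (receivedPower α Pu D x m))
      ∂(κ.prod ((expMeasure 1).prod (expMeasure 1))) =
      ∫⁻ z, (1 - ∫⁻ f, ENNReal.ofReal (expNeg s (receivedPower α Pu D x (z, f)))
        ∂((expMeasure 1).prod (expMeasure 1))) ∂κ := by
  have : IsProbabilityMeasure (expMeasure 1) := isProbabilityMeasure_expMeasure one_pos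
  have hx : Measurable fun m => ENNReal.ofReal (expNeg s (receivedPower α Pu D x m)) :=
    (measurable_ofReal_expNeg_receivedPower α Pu s hD).of_uncurry_left
  exact one_sub_lintegral_prod hx fun m => by simpa using expNeg_le_one hs _

/-- Tonelli moves the mark average outside the spatial integral, where the bound for a fixed mark
applies. -/
lemma ofReal_integral_powerQuotient_le_lintegral {α Pu s : ℝ} (hα : 2 < α) (hPu : 0 ≤ Pu)
    (hs : 0 < s) {κ : Measure (ℝ × Plane)} [IsProbabilityMeasure κ] (hP : ∀ᵐ z ∂κ, 0 ≤ z.1)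
    (hmom : Integrable (fun z => z.1 ^ (2 / α)) κ) {D : Plane → Plane} (hD : Measurable D) :
    ENNReal.ofReal (spatialConst (2 / α) * s ^ (2 / α) *
      ∫ z, powerQuotient (2 / α) Pu z.1 ∂κ) ≤
      ∫⁻ x, (1 - ∫⁻ m, ENNReal.ofReal (expNeg s (receivedPower α Pu D x m))
        ∂(κ.prod ((expMeasure 1).prod (expMeasure 1)))) := by
  have hδ0 : 0 < 2 / α := by positivity
  have hδ1 : 2 / α < 1 := by rw [div_lt_one] <;> linarith
  have hC := spatialConst_nonneg hδ0 hδ1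
  simp_rw [one_sub_lintegral_mark α Pu hs.le hD]
  rw [lintegral_lintegral_swap
      (measurable_const.sub (measurable_lintegral_fading α Pu s hD)).aemeasurable,
    ← integral_const_mul, ofReal_integral_eq_lintegral_ofReal
      ((integrable_powerQuotient hδ0 hδ1 hPu hP hmom).const_mul _)]
  · refine lintegral_mono_ae ?_
    filter_upwards [hP] with z hz
    exact ofReal_powerQuotient_le_lintegral hα hPu hs D hz
  · filter_upwards [hP] with z hz
    have := powerQuotient_nonneg hδ0.le hPu hz
    simp only [Pi.zero_apply]
    positivity

/-! ### Assembly of the Laplace transform bound -/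

lemma laplaceTransform_receivedPower_le {Ω : Type*} [MeasurableSpace Ω] {μ : Measure Ω}
    [IsProbabilityMeasure μ] {α lam Pu s : ℝ} (hα : 2 < α) (hlam : 0 < lam) (hPu : 0 ≤ Pu)
    {κ : Measure (ℝ × Plane)} [IsProbabilityMeasure κ] (hP : ∀ᵐ z ∂κ, 0 ≤ z.1)
    (hmom : Integrable (fun z => z.1 ^ (2 / α)) κ)
    {x : ℕ → Ω → Plane} {P : ℕ → Ω → ℝ} {Y : ℕ → Ω → Plane} {h h' : ℕ → Ω → ℝ}
    (hnet : IsFullDuplexNetwork μ lam κ x P Y h h') (hs : 0 < s) {D : Plane → Plane}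
    (hD : Measurable D) :
    laplaceTransform μ (interference α Pu x (fun i ω => x i ω + D (Y i ω)) P h h') s ≤
      Real.exp (-(lam * spatialConst (2 / α) * s ^ (2 / α) *
        ∫ z, powerQuotient (2 / α) Pu z.1 ∂κ)) := by
  have : IsProbabilityMeasure (expMeasure 1) := isProbabilityMeasure_expMeasure one_pos
  have : SigmaFinite (ENNReal.ofReal lam • (volume : Measure Plane)) :=
    inferInstanceAs (SigmaFinite (lam.toNNReal • (volume : Measure Plane)))
  refine (ENNReal.ofReal_le_ofReal_iff (Real.exp_pos _).le).1
    (hnet.poisson.le_exp_of_le_lintegral_prod (φ := fun x => ∫⁻ m,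
      ENNReal.ofReal (expNeg s (receivedPower α Pu D x m))
        ∂(κ.prod ((expMeasure 1).prod (expMeasure 1)))) (fun x => ?_) (fun N => ?_) ?_)
  · refine (lintegral_mono (g := fun _ => 1) fun m => ?_).trans_eq (by simp)
    simpa using expNeg_le_one hs.le _
  · rw [← lintegral_prod_marked hnet.poisson.measurable hnet.mark_law hnet.mark_indep
      hnet.point_mark_indep (measurable_ofReal_expNeg_receivedPower α Pu s hD) N]
    exact ofReal_laplaceTransform_tsum_le μ (fun i ω => receivedPower α Pu D (x i ω)
      ((P i ω, Y i ω), (h i ω, h' i ω))) hs.le N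
  · rw [lintegral_smul_measure, smul_eq_mul, mul_assoc, mul_assoc, ENNReal.ofReal_mul hlam.le,
      ← mul_assoc (spatialConst _)]
    exact mul_le_mul_right (ofReal_integral_powerQuotient_le_lintegral hα hPu hs hP hmom hD) _

/-- First inequality: interfering BSs and their UEs are co-located. Second inequality: the UE of
the BS at `x i` is at `x i + Y i`. -/
theorem lemma1 {Ω : Type*} [MeasurableSpace Ω] (μ : Measure Ω) [IsProbabilityMeasure μ]
    (α δ lamb Pu : ℝ) (hα : 2 < α) (hδ : δ = 2 / α) (hlamb : 0 < lamb) (hPu : 0 ≤ Pu)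
    (κ : Measure (ℝ × Plane)) [IsProbabilityMeasure κ]
    (hP_nonneg : ∀ᵐ z ∂κ, 0 ≤ z.1) (hP_moment : Integrable (fun z => z.1 ^ δ) κ)
    (x : ℕ → Ω → Plane) (P : ℕ → Ω → ℝ) (Y : ℕ → Ω → Plane) (h h' : ℕ → Ω → ℝ)
    (hnet : IsFullDuplexNetwork μ lamb κ x P Y h h') (s : ℝ) (hs : 0 ≤ s) :
    Integrable (fun z => powerQuotient δ Pu z.1) κ ∧
    laplaceTransform μ (interference α Pu x x P h h') s ≤
      Real.exp (-(lamb * (Real.pi ^ 2 * δ / Real.sin (Real.pi * δ)) * s ^ δ *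
        ∫ z, powerQuotient δ Pu z.1 ∂κ)) ∧
    laplaceTransform μ (interference α Pu x (fun i ω => x i ω + Y i ω) P h h') s ≤
      Real.exp (-(lamb * (Real.pi ^ 2 * δ / Real.sin (Real.pi * δ)) * s ^ δ *
        ∫ z, powerQuotient δ Pu z.1 ∂κ)) := by

  subst hδ
  have hδ0 : 0 < 2 / α := by positivity
  have hδ1 : 2 / α < 1 := by rw [div_lt_one] <;> linarith
  have bound : ∀ D : Plane → Plane, Measurable D →
      laplaceTransform μ (interference α Pu x (fun i ω => x i ω + D (Y i ω)) P h h') s ≤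
      Real.exp (-(lamb * spatialConst (2 / α) * s ^ (2 / α) *
        ∫ z, powerQuotient (2 / α) Pu z.1 ∂κ)) := by
    intro D hD
    -- At `s = 0` the bound is `1`, as `0 ^ δ = 0`; the scaling of the power quotient by `s ^ δ` is
    -- used only for `s > 0`.
    rcases hs.eq_or_lt with rfl | hs
    · rw [Real.zero_rpow hδ0.ne', mul_zero, zero_mul, neg_zero, Real.exp_zero, laplaceTransform_eq]
      refine (integral_mono_of_nonneg (Filter.Eventually.of_forall fun ω => expNeg_nonneg 0 _)
        (integrable_const 1) (Filter.Eventually.of_forall fun ω => expNeg_le_one le_rfl _)).trans_eq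
        (by simp)
    · exact laplaceTransform_receivedPower_le hα hlamb hPu hP_nonneg hP_moment hnet hs hD
  refine ⟨integrable_powerQuotient hδ0 hδ1 hPu hP_nonneg hP_moment, ?_, bound id measurable_id⟩
  have hcoloc := bound (fun _ => 0) measurable_const
  simp only [add_zero] at hcoloc
  exact hcoloc
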